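/- Let $L=(l_1,l_2,l_3)$ be a triple of positive integers and put $n=l_1+l_2+l_3$. Suppose that $L$ is generic, i.e. for all $I,J\subseteq\{1,2,3\}$, $\sum_{i\in I}l_i=\sum_{j\in J}l_j$ implies $I=J$, and reduced, i.e. $\gcd(l_1,l_2,l_3)=1$. Let $\mathrm{Tonn}^{n,3}(L)$ be the generalized tonnetz, that is, the abstract simplicial complex on the vertex set $\mathbb{Z}/n$ whose simplices are the nonempty subsets of the sets $$\Delta(x;\sigma)=\{x,\ x+l_{\sigma(1)},\ x+l_{\sigma(1)}+l_{\sigma(2)}\},\qquad x\in\mathbb{Z}/n,\ \sigma\in\Sigma_3,$$ where $\Sigma_3$ is the group of permutations of $\{1,2,3\}$. Then $\mathrm{Tonn}^{n,3}(L)$ is a triangulation of the $2$-dimensional torus $T^2=(S^1)^2$, i.e. its geometric realization is homeomorphic to $S^1\times S^1$. -/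

import Mathlib

namespace Tonnetz

/-- The geometric realization `|K|` of a simplicial complex `K` with finitely many vertices, in
barycentric coordinates. As a type it carries the subspace topology from `V → ℝ`, which for
finitely many vertices is the usual topology of the realization. -/
def realization {V : Type*} [Fintype V] (K : PreAbstractSimplicialComplex V) : Set (V → ℝ) :=
  {p | (∀ v, 0 ≤ p v) ∧ ∑ v, p v = 1 ∧ ∃ s ∈ K.faces, ∀ v, p v ≠ 0 → v ∈ s}

/-- `K` is a triangulation of `X`: the geometric realization of `K` is homeomorphic to `X`. -/
def IsTriangulationOf {V : Type*} [Fintype V] (K : PreAbstractSimplicialComplex V)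
    (X : Type*) [TopologicalSpace X] : Prop :=
  Nonempty (realization K ≃ₜ X)

/-- `L` is generic: subsets of the index set with equal `L`-sums are equal. -/
def IsGeneric {k : ℕ} (L : Fin k → ℕ) : Prop :=
  ∀ I J : Finset (Fin k), ∑ i ∈ I, L i = ∑ j ∈ J, L j → I = J

/-- `L` is reduced: the greatest common divisor of all `L i` is `1`. -/
def IsReduced {k : ℕ} (L : Fin k → ℕ) : Prop :=
  Finset.univ.gcd L = 1

/-- The set `Δ(x; σ)` of the `k` points
`x, x + L (σ 0), x + L (σ 0) + L (σ 1), …, x + L (σ 0) + ⋯ + L (σ (k - 2))` of `ℤ/n`. -/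
def simplex (n : ℕ) {k : ℕ} (L : Fin k → ℕ) (x : ZMod n) (σ : Equiv.Perm (Fin k)) :
    Finset (ZMod n) :=
  Finset.univ.image fun m : Fin k => x + ∑ j ∈ Finset.univ.filter (· < m), (L (σ j) : ZMod n)

/-- The generalized tonnetz `Tonn^{n,k}(L)`: the simplicial complex of all nonempty subsets of the
sets `Δ(x; σ)`. -/
def tonn (n : ℕ) {k : ℕ} (L : Fin k → ℕ) : PreAbstractSimplicialComplex (ZMod n) where
  faces := {s | s.Nonempty ∧ ∃ x σ, s ⊆ simplex n L x σ}
  isRelLowerSet_faces := by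
    rintro s ⟨hs, x, σ, hsub⟩
    exact ⟨hs, fun t hts ht => ⟨ht, x, σ, hts.trans hsub⟩⟩

end Tonnetz

/-! Triangulate the plane by the horizontal, vertical and diagonal lines through `ℤ × ℤ`, and label
the lattice point `(a, b)` by `a * l₁ + b * l₂` in `ℤ/n`. As `l₃ = -(l₁ + l₂)` there, the triangles
of the plane carry exactly the label sets `Δ(x; σ)`, so the piecewise linear extension `planeMap` of
the labelling maps the plane to the realization. Reducedness makes the labelling surjective, hence
`planeMap` is onto (`range_planeMap_latticeHom`).

Genericity makes the labelling injective on a lattice point and its six neighbours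
(`latticeHom_injOn_starPoints`). Barycentric coordinates then determine a point within an open star,
and since the labelling is a homomorphism, two points have the same image exactly when they differ
by an element of its kernel (`planeMap_eq_iff`). The kernel is a rank 2 lattice
(`exists_kernel_basis`), so the realization is the plane modulo a lattice, a torus
(`nonempty_homeomorph_torus`). -/

namespace Tonnetz

/-! ### The hat function of the triangulated plane -/

/-- The piecewise linear function on the plane, triangulated by the horizontal, vertical and
diagonal lines through lattice points, which is `1` at the origin and `0` at all other lattice
points. -/
noncomputable def hat (p : ℝ × ℝ) : ℝ :=
  max 0 (1 - (max 0 (max p.1 p.2) - min 0 (min p.1 p.2)))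

theorem continuous_hat : Continuous hat := by
  unfold hat
  fun_prop

theorem abs_lt_one_of_hat_ne_zero {x y : ℝ} (h : hat (x, y) ≠ 0) :
    (-1 < x ∧ x < 1) ∧ (-1 < y ∧ y < 1) ∧ -1 < x - y ∧ x - y < 1 := by
  have h' : 0 < 1 - (max 0 (max x y) - min 0 (min x y)) := by
    by_contra hc
    exact h (max_eq_left (not_lt.mp hc))
  have h1 : x ≤ max 0 (max x y) := by simp
  have h2 : y ≤ max 0 (max x y) := by simp
  have h3 : 0 ≤ max 0 (max x y) := by simp
  have h4 : min 0 (min x y) ≤ x := by simp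
  have h5 : min 0 (min x y) ≤ y := by simp
  have h6 : min 0 (min x y) ≤ 0 := by simp
  refine ⟨⟨?_, ?_⟩, ⟨?_, ?_⟩, ?_, ?_⟩ <;> linarith

/-- The lattice points of the closed star of the origin. -/
def starPoints : Finset (ℤ × ℤ) :=
  {(0, 0), (1, 0), (1, 1), (0, 1), (-1, 0), (-1, -1), (0, -1)}

theorem mem_starPoints {a b : ℤ} (ha : -1 ≤ a ∧ a ≤ 1) (hb : -1 ≤ b ∧ b ≤ 1)
    (hab : -1 ≤ a - b ∧ a - b ≤ 1) : (a, b) ∈ starPoints := by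
  simp only [starPoints, Finset.mem_insert, Finset.mem_singleton, Prod.mk.injEq]
  omega

/-- The lattice point `u` in the real plane. -/
def toPlane (u : ℤ × ℤ) : ℝ × ℝ := (u.1, u.2)

theorem mem_starPoints_of_hat_ne_zero {p : ℝ × ℝ} {u : ℤ × ℤ} (hp : hat p ≠ 0)
    (hu : hat (p - toPlane u) ≠ 0) : u ∈ starPoints := by
  obtain ⟨x, y⟩ := p
  obtain ⟨a, b⟩ := u
  obtain ⟨⟨h1, h2⟩, ⟨h3, h4⟩, h5, h6⟩ := abs_lt_one_of_hat_ne_zero hp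
  obtain ⟨⟨k1, k2⟩, ⟨k3, k4⟩, k5, k6⟩ := abs_lt_one_of_hat_ne_zero
    (x := x - a) (y := y - b) hu
  have a1 : -2 < a := by exact_mod_cast (by linarith : (-2 : ℝ) < a)
  have a2 : a < 2 := by exact_mod_cast (by linarith : (a : ℝ) < 2)
  have b1 : -2 < b := by exact_mod_cast (by linarith : (-2 : ℝ) < b)
  have b2 : b < 2 := by exact_mod_cast (by linarith : (b : ℝ) < 2)
  have c1 : -2 < a - b := by exact_mod_cast (by linarith : (-2 : ℝ) < a - b)
  have c2 : a - b < 2 := by exact_mod_cast (by linarith : (a - b : ℝ) < 2)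
  exact mem_starPoints (by omega) (by omega) (by omega)

theorem hat_neg (p : ℝ × ℝ) : hat (-p) = hat p := by
  simp only [hat, Prod.fst_neg, Prod.snd_neg]
  grind

theorem hat_sub_one_zero {x y : ℝ} (h : hat (x, y) ≠ 0) :
    hat (x - 1, y) = max 0 (min x (x - y)) := by
  obtain ⟨⟨h1, h2⟩, ⟨h3, h4⟩, h5, h6⟩ := abs_lt_one_of_hat_ne_zero h
  simp only [hat]
  clear h
  grind

theorem hat_sub_one_one {x y : ℝ} (h : hat (x, y) ≠ 0) :
    hat (x - 1, y - 1) = max 0 (min x y) := by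
  obtain ⟨⟨h1, h2⟩, ⟨h3, h4⟩, h5, h6⟩ := abs_lt_one_of_hat_ne_zero h
  simp only [hat]
  clear h
  grind

theorem hat_sub_zero_one {x y : ℝ} (h : hat (x, y) ≠ 0) :
    hat (x, y - 1) = max 0 (min y (y - x)) := by
  obtain ⟨⟨h1, h2⟩, ⟨h3, h4⟩, h5, h6⟩ := abs_lt_one_of_hat_ne_zero h
  simp only [hat]
  clear h
  grind

/-- In the open star of the origin, a point is determined by its barycentric coordinates. -/
theorem sum_starPoints_hat {p : ℝ × ℝ} (hp : hat p ≠ 0) :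
    ∑ u ∈ starPoints, hat (p - toPlane u) • toPlane u = p := by
  obtain ⟨x, y⟩ := p
  -- The point symmetry of `hat` yields the coordinates at the three opposite neighbours.
  have hn : hat (-x, -y) ≠ 0 := by rwa [← hat_neg] at hp
  have e1 := hat_sub_one_zero hp
  have e2 := hat_sub_one_one hp
  have e3 := hat_sub_zero_one hp
  have e4 := hat_sub_one_zero hn
  have e5 := hat_sub_one_one hn
  have e6 := hat_sub_zero_one hn
  rw [← hat_neg] at e4 e5 e6
  simp only [Prod.neg_mk, neg_sub, neg_neg, sub_neg_eq_add, add_comm (1 : ℝ)] at e4 e5 e6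
  simp [starPoints, toPlane, e1, e2, e3, e4, e5, e6]
  grind

theorem hat_swap (p : ℝ × ℝ) : hat p.swap = hat p := by
  simp only [hat, Prod.fst_swap, Prod.snd_swap, max_comm p.2, min_comm p.2]

theorem hat_eq_of_le {x y : ℝ} (hy : 0 ≤ y) (hxy : y ≤ x) (hx : x ≤ 1) :
    hat (x, y) = 1 - x ∧ hat (x - 1, y) = x - y ∧ hat (x - 1, y - 1) = y := by
  simp only [hat]
  grind

theorem eq_vertex_of_hat_ne_zero {x y : ℝ} (hy : 0 ≤ y) (hxy : y ≤ x) (hx : x ≤ 1)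
    {u : ℤ × ℤ} (hu : hat ((x, y) - toPlane u) ≠ 0) : u = (0, 0) ∨ u = (1, 0) ∨ u = (1, 1) := by
  obtain ⟨a, b⟩ := u
  obtain ⟨⟨k1, k2⟩, ⟨k3, k4⟩, k5, k6⟩ := abs_lt_one_of_hat_ne_zero
    (x := x - a) (y := y - b) hu
  have a1 : -1 < a := by exact_mod_cast (by linarith : (-1 : ℝ) < a)
  have a2 : a < 2 := by exact_mod_cast (by linarith : (a : ℝ) < 2)
  have b1 : -1 < b := by exact_mod_cast (by linarith : (-1 : ℝ) < b)
  have b2 : b < 2 := by exact_mod_cast (by linarith : (b : ℝ) < 2)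
  have c1 : -1 < a - b := by exact_mod_cast (by linarith : (-1 : ℝ) < a - b)
  simp only [Prod.mk.injEq]
  omega

theorem locallyFinite_support_hat :
    LocallyFinite fun u : ℤ × ℤ => Function.support fun p => hat (p - toPlane u) := by
  intro p
  refine ⟨Metric.ball p 1, Metric.ball_mem_nhds p one_pos, ?_⟩
  refine ((Set.finite_Icc (⌊p.1⌋ - 2) (⌊p.1⌋ + 2)).prod
    (Set.finite_Icc (⌊p.2⌋ - 2) (⌊p.2⌋ + 2))).subset ?_
  rintro ⟨a, b⟩ ⟨⟨x, y⟩, hq, hd⟩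
  obtain ⟨x₀, y₀⟩ := p
  obtain ⟨⟨k1, k2⟩, ⟨k3, k4⟩, -⟩ := abs_lt_one_of_hat_ne_zero
    (x := x - a) (y := y - b) hq
  rw [Metric.mem_ball, Prod.dist_eq, max_lt_iff, Real.dist_eq, Real.dist_eq, abs_lt, abs_lt] at hd
  obtain ⟨⟨d1, d2⟩, d3, d4⟩ := hd
  have f1 := Int.floor_le x₀
  have f2 := Int.lt_floor_add_one x₀
  have f3 := Int.floor_le y₀
  have f4 := Int.lt_floor_add_one y₀
  simp only at d1 d2 d3 d4
  have a1 : ⌊x₀⌋ - 2 < a := by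
    exact_mod_cast (by push_cast; linarith : ((⌊x₀⌋ - 2 : ℤ) : ℝ) < a)
  have a2 : a < ⌊x₀⌋ + 3 := by
    exact_mod_cast (by push_cast; linarith : (a : ℝ) < (⌊x₀⌋ + 3 : ℤ))
  have b1 : ⌊y₀⌋ - 2 < b := by
    exact_mod_cast (by push_cast; linarith : ((⌊y₀⌋ - 2 : ℤ) : ℝ) < b)
  have b2 : b < ⌊y₀⌋ + 3 := by
    exact_mod_cast (by push_cast; linarith : (b : ℝ) < (⌊y₀⌋ + 3 : ℤ))
  simp only [Set.mem_prod, Set.mem_Icc]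
  omega

/-! ### The map from the plane to barycentric coordinates -/

section Labelling

variable {V : Type*} [DecidableEq V]

/-- The barycentric coordinates of the image of a point of the plane under the map that is affine
on triangles and sends each lattice point `u` to the vertex `f u`. -/
noncomputable def planeMap (f : ℤ × ℤ → V) (p : ℝ × ℝ) (v : V) : ℝ :=
  ∑ᶠ u : ℤ × ℤ, if f u = v then hat (p - toPlane u) else 0

theorem continuous_planeMap (f : ℤ × ℤ → V) : Continuous (planeMap f) := by
  refine continuous_pi fun v => continuous_finsum (fun u => ?_) ?_
  · split_ifs
    · exact continuous_hat.comp (by fun_prop)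
    · exact continuous_const
  · refine locallyFinite_support_hat.subset fun u p hp => ?_
    simp only [Function.mem_support, ne_eq, ite_eq_right_iff, Classical.not_imp] at hp ⊢
    exact hp.2

theorem exists_of_planeMap_ne_zero {f : ℤ × ℤ → V} {p : ℝ × ℝ} {v : V}
    (h : planeMap f p v ≠ 0) : ∃ u, f u = v ∧ hat (p - toPlane u) ≠ 0 := by
  contrapose! h
  refine finsum_eq_zero_of_forall_eq_zero fun u => ?_
  split_ifs with hu
  exacts [h u hu, rfl]

theorem planeMap_eq_sum {f : ℤ × ℤ → V} {p : ℝ × ℝ} {s : Finset (ℤ × ℤ)}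
    (hs : ∀ u, hat (p - toPlane u) ≠ 0 → u ∈ s) (v : V) :
    planeMap f p v = ∑ u ∈ s, if f u = v then hat (p - toPlane u) else 0 := by
  refine finsum_eq_sum_of_support_subset _ fun u hu => hs u ?_
  simp only [Function.mem_support, ne_eq, ite_eq_right_iff, Classical.not_imp] at hu
  exact hu.2

theorem planeMap_add_toPlane (f : ℤ × ℤ → V) (p : ℝ × ℝ) (w : ℤ × ℤ) :
    planeMap f (p + toPlane w) = planeMap (fun u => f (u + w)) p := by
  funext v
  refine (finsum_comp_equiv (Equiv.addRight w)).symm.trans (finsum_congr fun u => ?_)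
  have : p + toPlane w - toPlane (u + w) = p - toPlane u := by
    ext <;> simp [toPlane]
  simp [this]

/-- On the triangle below the diagonal only its three vertices have nonzero hat functions. Adding
`Pi.single` terms avoids assuming that the labels are distinct. -/
theorem planeMap_of_le (f : ℤ × ℤ → V) {x y : ℝ} (hy : 0 ≤ y) (hxy : y ≤ x) (hx : x ≤ 1) :
    planeMap f (x, y) = Pi.single (f (0, 0)) (1 - x) + Pi.single (f (1, 0)) (x - y) +
      Pi.single (f (1, 1)) y := by
  obtain ⟨h1, h2, h3⟩ := hat_eq_of_le hy hxy hx
  funext v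
  rw [planeMap_eq_sum (s := {(0, 0), (1, 0), (1, 1)})
    fun u hu => by simpa using eq_vertex_of_hat_ne_zero hy hxy hx hu]
  simp [toPlane, h1, h2, h3, Pi.single_apply, eq_comm (a := v), add_assoc]

/-- Reflection in the diagonal preserves the triangulation, so triangles above the diagonal reduce
to those below. -/
theorem planeMap_swap (f : ℤ × ℤ → V) (p : ℝ × ℝ) :
    planeMap f p.swap = planeMap (fun u => f u.swap) p := by
  funext v
  refine (finsum_comp_equiv (Equiv.prodComm ℤ ℤ)).symm.trans (finsum_congr fun u => ?_)
  rw [← hat_swap]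
  rfl

/-- If `f` is injective on the star of the origin, the barycentric coordinates of the image
determine a point of the open star. -/
theorem planeMap_injOn_star {f : ℤ × ℤ → V} (hf : Set.InjOn f starPoints) :
    Set.InjOn (planeMap f) {p | hat p ≠ 0} := by
  -- Only star points contribute in the open star, and their labels are distinct, so each coordinate
  -- is a single hat value.
  have key : ∀ p, hat p ≠ 0 → ∀ u ∈ starPoints, planeMap f p (f u) = hat (p - toPlane u) := by
    intro p hp u hu
    rw [planeMap_eq_sum fun w hw => mem_starPoints_of_hat_ne_zero hp hw,
      Finset.sum_eq_single_of_mem u hu]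
    · simp
    · intro w hw hwu
      exact if_neg fun h => hwu (hf hw hu h)
  intro p hp q hq h
  rw [← sum_starPoints_hat hp, ← sum_starPoints_hat hq]
  refine Finset.sum_congr rfl fun u hu => ?_
  rw [← key p hp u hu, ← key q hq u hu, h]

end Labelling

/-! ### Fibres of the plane map and the kernel lattice -/

/-- If `φ` is injective on the star of the origin, the fibres of `planeMap φ` are the orbits of
`ker φ`. -/
theorem planeMap_eq_iff {V : Type*} [DecidableEq V] [AddGroup V] (φ : ℤ × ℤ →+ V)
    (hφ : Set.InjOn φ starPoints) {p q : ℝ × ℝ} (hp : planeMap φ p ≠ 0) :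
    planeMap φ p = planeMap φ q ↔ ∃ w, φ w = 0 ∧ p = q + toPlane w := by
  constructor
  · intro h
    -- A vertex `v` with nonzero coordinate gives lattice points `u`, `u'` labelled `v` whose open
    -- stars contain `p` and `q`. Translating both to the origin yields the same labelling `φ + v`,
    -- so injectivity on the star gives `p - u = q - u'`.
    obtain ⟨v, hv⟩ := Function.ne_iff.mp hp
    obtain ⟨u, hu, hpu⟩ := exists_of_planeMap_ne_zero hv
    obtain ⟨u', hu', hqu⟩ := exists_of_planeMap_ne_zero (h ▸ hv)
    have hadd : ∀ w, φ w = v → (fun a => φ (a + w)) = fun a => φ a + v := by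
      intro w hw
      funext a
      rw [map_add, hw]
    have hinj : Set.InjOn (fun a => φ a + v) starPoints := fun a ha b hb hab =>
      hφ ha hb (add_right_cancel hab)
    have hshift : planeMap (fun a => φ a + v) (p - toPlane u) =
        planeMap (fun a => φ a + v) (q - toPlane u') := by
      rw [← hadd u hu, ← planeMap_add_toPlane, hadd u hu, ← hadd u' hu', ← planeMap_add_toPlane,
        sub_add_cancel, sub_add_cancel, h]
    have heq := planeMap_injOn_star hinj hpu hqu hshift
    refine ⟨u - u', by rw [map_sub, hu, hu', sub_self], ?_⟩
    rw [sub_eq_iff_eq_add] at heq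
    rw [heq]
    ext <;> simp [toPlane] <;> ring
  · rintro ⟨w, hw, rfl⟩
    rw [planeMap_add_toPlane]
    simp only [map_add, hw, add_zero]

/-- The kernel of a homomorphism from `ℤ × ℤ` to a finite cyclic group has a basis in
Hermite normal form. -/
theorem exists_kernel_basis {n : ℕ} [NeZero n] (φ : ℤ × ℤ →+ ZMod n) :
    ∃ A C D : ℤ, A ≠ 0 ∧ D ≠ 0 ∧ ∀ u, φ u = 0 ↔ ∃ i j : ℤ, u = (i * A + j * C, j * D) := by
  have hn : ∀ u, φ (n • u) = 0 := fun u => by rw [map_nsmul]; simp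
  have hn0 : (n : ℤ) ≠ 0 := by exact_mod_cast NeZero.ne n
  -- `A` generates the kernel on the first axis and `D` its projection to the second; `(C, D)` will
  -- be a lift of `D`. Both are nonzero because `n` kills the target.
  obtain ⟨A, hA⟩ := Int.subgroup_cyclic (φ.ker.comap (AddMonoidHom.inl ℤ ℤ))
  obtain ⟨D, hD⟩ := Int.subgroup_cyclic (φ.ker.map (AddMonoidHom.snd ℤ ℤ))
  have hA' : ∀ a, φ (a, 0) = 0 ↔ ∃ i : ℤ, i * A = a := by
    intro a
    have := SetLike.ext_iff.mp hA a
    rwa [AddSubgroup.mem_closure_singleton] at this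
  have hD' : ∀ b, (∃ a, φ (a, b) = 0) ↔ ∃ j : ℤ, j * D = b := by
    intro b
    have := SetLike.ext_iff.mp hD b
    rw [AddSubgroup.mem_closure_singleton] at this
    simpa [AddMonoidHom.mem_ker] using this
  obtain ⟨C, hC⟩ := (hD' D).mpr ⟨1, one_mul D⟩
  refine ⟨A, C, D, ?_, ?_, ?_⟩
  · rintro rfl
    obtain ⟨i, hi⟩ := (hA' n).mp (by simpa using hn (1, 0))
    exact hn0 (by simpa using hi.symm)
  · rintro rfl
    obtain ⟨i, hi⟩ := (hD' n).mp ⟨0, by simpa using hn (0, 1)⟩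
    exact hn0 (by simpa using hi.symm)
  · rintro ⟨a, b⟩
    have hj : ∀ j : ℤ, φ (j * C, j * D) = 0 := fun j => by
      rw [show (j * C, j * D) = j • (C, D) by simp, map_zsmul, hC, smul_zero]
    constructor
    · intro h
      obtain ⟨j, rfl⟩ := (hD' b).mp ⟨a, h⟩
      have : φ (a - j * C, 0) = 0 := by
        rw [show (a - j * C, (0 : ℤ)) = (a, j * D) - (j * C, j * D) by simp, map_sub, h, hj,
          sub_zero]
      obtain ⟨i, hi⟩ := (hA' _).mp this
      exact ⟨i, j, by rw [hi, sub_add_cancel]⟩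
    · rintro ⟨i, j, h⟩
      rw [h, show (i * A + j * C, j * D) = (i * A, 0) + (j * C, j * D) by simp, map_add, hj,
        (hA' _).mpr ⟨i, rfl⟩, add_zero]

/-! ### The tonnetz -/

/-- The homomorphism sending the lattice points to the vertices of the tonnetz. -/
def latticeHom (n : ℕ) (L : Fin 3 → ℕ) : ℤ × ℤ →+ ZMod n where
  toFun u := u.1 * L 0 + u.2 * L 1
  map_zero' := by simp
  map_add' u w := by simp; ring

theorem latticeHom_apply (n : ℕ) (L : Fin 3 → ℕ) (a b : ℤ) :
    latticeHom n L (a, b) = a * L 0 + b * L 1 := rfl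

theorem cast_two {n : ℕ} {L : Fin 3 → ℕ} (hsum : ∑ i, L i = n) :
    (L 2 : ZMod n) = -(L 0 + L 1) := by
  have : ((∑ i, L i : ℕ) : ZMod n) = 0 := by rw [hsum, ZMod.natCast_self]
  rw [Fin.sum_univ_three] at this
  push_cast at this
  linear_combination this

theorem latticeHom_surjective {n : ℕ} {L : Fin 3 → ℕ} (hsum : ∑ i, L i = n)
    (hred : IsReduced L) : Function.Surjective (latticeHom n L) := by
  have hg : Nat.gcd (L 0) (Nat.gcd (L 1) (L 2)) = 1 := by
    rw [← hred, show (Finset.univ : Finset (Fin 3)) = {0, 1, 2} from rfl]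
    simp [Finset.gcd_insert]
    rfl
  have h1 := Nat.gcd_eq_gcd_ab (L 0) (Nat.gcd (L 1) (L 2))
  rw [Nat.gcd_eq_gcd_ab (L 1) (L 2), hg] at h1
  have h2 := congrArg (Int.cast : ℤ → ZMod n) h1
  set r := Nat.gcdA (L 0) (Nat.gcd (L 1) (L 2))
  set s := Nat.gcdB (L 0) (Nat.gcd (L 1) (L 2))
  set t := Nat.gcdA (L 1) (L 2)
  set k := Nat.gcdB (L 1) (L 2)
  push_cast at h2
  rw [cast_two hsum] at h2
  intro x
  obtain ⟨m, rfl⟩ := ZMod.intCast_surjective x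
  refine ⟨(m * (r - k * s), m * (t * s - k * s)), ?_⟩
  rw [latticeHom_apply]
  push_cast
  linear_combination -(m : ZMod n) * h2

/-- The labels on the star are `0` and `±lᵢ` modulo `n`. A coincidence `lᵢ = lⱼ` or `lᵢ = -lᵢ` would
make two lengths equal, or one the sum of the other two, against genericity; positivity excludes the
rest. -/
theorem latticeHom_injOn_starPoints {n : ℕ} {L : Fin 3 → ℕ} (hpos : ∀ i, 0 < L i)
    (hsum : ∑ i, L i = n) (hgen : IsGeneric L) :
    Set.InjOn (latticeHom n L) starPoints := by
  have g1 : L 0 ≠ L 1 := fun h => by simpa using hgen {0} {1} (by simpa using h)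
  have g2 : L 0 ≠ L 2 := fun h => by simpa using hgen {0} {2} (by simpa using h)
  have g3 : L 1 ≠ L 2 := fun h => by simpa using hgen {1} {2} (by simpa using h)
  have g4 : L 0 ≠ L 1 + L 2 := fun h => by
    simpa using congrArg (0 ∈ ·) (hgen {0} {1, 2} (by simpa using h))
  have g5 : L 1 ≠ L 0 + L 2 := fun h => by
    simpa using congrArg (1 ∈ ·) (hgen {1} {0, 2} (by simpa using h))
  have g6 : L 2 ≠ L 0 + L 1 := fun h => by
    simpa using congrArg (2 ∈ ·) (hgen {2} {0, 1} (by simpa using h))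
  have p0 := hpos 0
  have p1 := hpos 1
  have p2 := hpos 2
  rw [Fin.sum_univ_three] at hsum
  rintro ⟨a, b⟩ hu ⟨c, d⟩ hw h
  rw [latticeHom_apply, latticeHom_apply, ← sub_eq_zero] at h
  have h' : (((a * L 0 + b * L 1) - (c * L 0 + d * L 1) : ℤ) : ZMod n) = 0 := by
    push_cast; exact h
  rw [ZMod.intCast_zmod_eq_zero_iff_dvd] at h'
  obtain ⟨k, hk⟩ := h'
  rw [← hsum] at hk
  clear h hgen hpos hsum
  generalize L 0 = x at *
  generalize L 1 = y at *
  generalize L 2 = z at *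
  have hstar : ∀ a b : ℤ, (a, b) ∈ (starPoints : Set (ℤ × ℤ)) →
      a = 0 ∧ b = 0 ∧ a * x + b * y = 0 ∨ a = 1 ∧ b = 0 ∧ a * x + b * y = x ∨
      a = 1 ∧ b = 1 ∧ a * x + b * y = x + y ∨ a = 0 ∧ b = 1 ∧ a * x + b * y = y ∨
      a = -1 ∧ b = 0 ∧ a * x + b * y = -x ∨ a = -1 ∧ b = -1 ∧ a * x + b * y = -x - y ∨
      a = 0 ∧ b = -1 ∧ a * x + b * y = -y := by
    intro a b hab
    simp only [starPoints, Finset.coe_insert, Finset.coe_singleton, Set.mem_insert_iff,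
      Set.mem_singleton_iff, Prod.mk.injEq] at hab
    rcases hab with ⟨rfl, rfl⟩ | ⟨rfl, rfl⟩ | ⟨rfl, rfl⟩ | ⟨rfl, rfl⟩ | ⟨rfl, rfl⟩ | ⟨rfl, rfl⟩ |
      ⟨rfl, rfl⟩ <;> omega
  replace hu := hstar a b hu
  replace hw := hstar c d hw
  generalize a * (x : ℤ) + b * y = r at *
  generalize c * (x : ℤ) + d * y = t at *
  push_cast at hk
  have hr : -(x + y : ℤ) ≤ r ∧ r ≤ x + y := by omega
  have ht : -(x + y : ℤ) ≤ t ∧ t ≤ x + y := by omega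
  -- Two star values differ by at most `2 * (x + y)`, which is less than `2 * n`.
  have hk1 : k < 2 := by nlinarith
  have hk2 : -2 < k := by nlinarith
  rw [Prod.mk.injEq]
  obtain rfl | rfl | rfl : k = -1 ∨ k = 0 ∨ k = 1 := by omega
  all_goals
    clear hstar
    rcases hu with hu | hu | hu | hu | hu | hu | hu <;> omega

theorem simplex_three (n : ℕ) (L : Fin 3 → ℕ) (x : ZMod n) (σ : Equiv.Perm (Fin 3)) :
    simplex n L x σ = {x, x + L (σ 0), x + (L (σ 0) + L (σ 1))} := by
  have h0 : (Finset.univ.filter (· < (0 : Fin 3))) = ∅ := by decide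
  have h1 : (Finset.univ.filter (· < (1 : Fin 3))) = {0} := by decide
  have h2 : (Finset.univ.filter (· < (2 : Fin 3))) = {0, 1} := by decide
  rw [simplex, show (Finset.univ : Finset (Fin 3)) = {0, 1, 2} from rfl]
  simp only [Finset.image_insert, Finset.image_singleton]
  rw [show ({0, 1, 2} : Finset (Fin 3)) = Finset.univ from rfl, h0, h1, h2]
  simp

/-! ### Recognizing the torus as a quotient of the plane -/

theorem exp_eq_exp_iff {s t : ℝ} : Circle.exp (2 * Real.pi * s) = Circle.exp (2 * Real.pi * t) ↔
    ∃ m : ℤ, s = t + m := by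
  rw [Circle.exp_eq_exp]
  refine exists_congr fun m => ?_
  rw [← sub_eq_zero, ← sub_eq_zero (a := s),
    show 2 * Real.pi * s - (2 * Real.pi * t + m * (2 * Real.pi)) =
      2 * Real.pi * (s - (t + m)) by ring]
  simp [Real.pi_ne_zero]

/-- A Hausdorff space with a continuous surjection from the plane whose fibres are the orbits of
`ℤ × ℤ` is a torus. -/
theorem nonempty_homeomorph_torus {Y : Type*} [TopologicalSpace Y] [T2Space Y] (g : ℝ × ℝ → Y)
    (hc : Continuous g) (hs : Function.Surjective g)
    (hg : ∀ p q, g p = g q ↔ ∃ w : ℤ × ℤ, p = q + toPlane w) :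
    Nonempty (Y ≃ₜ Circle × Circle) := by
  let S := Set.Icc (0 : ℝ) 1 ×ˢ Set.Icc (0 : ℝ) 1
  have hS : CompactSpace S := isCompact_iff_compactSpace.mp (isCompact_Icc.prod isCompact_Icc)
  let e : ℝ × ℝ → Circle × Circle := fun p =>
    (Circle.exp (2 * Real.pi * p.1), Circle.exp (2 * Real.pi * p.2))
  have hec : Continuous e := by fun_prop
  have hes : Function.Surjective e := by
    rintro ⟨z, w⟩
    refine ⟨(Complex.arg z / (2 * Real.pi), Complex.arg w / (2 * Real.pi)), ?_⟩
    have h (x : ℝ) : 2 * Real.pi * (x / (2 * Real.pi)) = x := by field_simp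
    simp only [e, h, Circle.exp_arg]
  have he : ∀ p q, e p = e q ↔ ∃ w : ℤ × ℤ, p = q + toPlane w := by
    rintro ⟨s, t⟩ ⟨s', t'⟩
    simp [e, exp_eq_exp_iff, toPlane]
  have hred : ∀ p : ℝ × ℝ, ∃ q : S, ∃ w : ℤ × ℤ, (q : ℝ × ℝ) = p + toPlane w := by
    rintro ⟨s, t⟩
    refine ⟨⟨(Int.fract s, Int.fract t), ?_⟩, (-⌊s⌋, -⌊t⌋), ?_⟩
    · exact ⟨⟨Int.fract_nonneg _, (Int.fract_lt_one _).le⟩,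
        ⟨Int.fract_nonneg _, (Int.fract_lt_one _).le⟩⟩
    · simp [toPlane, Int.fract, sub_eq_add_neg]
  let g' : C(S, Y) := ⟨fun p => g p, hc.comp continuous_subtype_val⟩
  let e' : C(S, Circle × Circle) := ⟨fun p => e p, hec.comp continuous_subtype_val⟩
  -- A continuous surjection from the compact square to a Hausdorff space is a quotient map, so both
  -- spaces are quotients of the square by the same relation.
  have hg' : Topology.IsQuotientMap g' := .of_surjective_continuous (fun y => by
    obtain ⟨p, rfl⟩ := hs y
    obtain ⟨q, hq⟩ := hred p
    exact ⟨q, (hg _ _).mpr hq⟩) g'.continuous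
  have he' : Topology.IsQuotientMap e' := .of_surjective_continuous (fun y => by
    obtain ⟨p, rfl⟩ := hes y
    obtain ⟨q, hq⟩ := hred p
    exact ⟨q, (he _ _).mpr hq⟩) e'.continuous
  have hker : Setoid.ker g' = Setoid.ker e' := by
    ext p q
    exact (hg _ _).trans (he _ _).symm
  refine ⟨hg'.homeomorph.symm.trans ?_⟩
  rw [hker]
  exact he'.homeomorph

/-! ### The triangles of the tonnetz and the image of the plane -/

/-- Since `l₁ + l₂ + l₃ = 0` in `ℤ/n`, rotating `σ` cyclically only moves the base point. The two
cyclic classes are the triangles below and above the diagonal. -/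
theorem simplex_eq_iff {n : ℕ} {L : Fin 3 → ℕ} (hsum : ∑ i, L i = n) (s : Finset (ZMod n)) :
    (∃ x σ, s = simplex n L x σ) ↔ ∃ y : ZMod n, s = {y, y + L 0, y + (L 0 + L 1)} ∨
      s = {y, y + L 1, y + (L 0 + L 1)} := by
  have hc := cast_two hsum
  constructor
  · rintro ⟨x, σ, rfl⟩
    rw [simplex_three]
    have hne : σ 0 ≠ σ 1 := by simp
    generalize σ 0 = i at *
    generalize σ 1 = j at *
    have hi : i = 0 ∨ i = 1 ∨ i = 2 := by omega
    have hj : j = 0 ∨ j = 1 ∨ j = 2 := by omega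
    rcases hi with rfl | rfl | rfl <;> rcases hj with rfl | rfl | rfl
    · exact absurd rfl hne
    · exact ⟨x, .inl rfl⟩
    · refine ⟨x - L 1, .inr ?_⟩
      rw [hc, sub_add_cancel,
        show x - (L 1 : ZMod n) + (L 0 + L 1) = x + L 0 by ring,
        show x + (L 0 + -(L 0 + L 1)) = x - (L 1 : ZMod n) by ring]
      grind
    · exact ⟨x, .inr (by rw [add_comm (L 1 : ZMod n)])⟩
    · exact absurd rfl hne
    · refine ⟨x - L 0, .inl ?_⟩
      rw [hc, sub_add_cancel,
        show x - (L 0 : ZMod n) + (L 0 + L 1) = x + L 1 by ring,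
        show x + (L 1 + -(L 0 + L 1)) = x - (L 0 : ZMod n) by ring]
      grind
    · refine ⟨x - (L 0 + L 1), .inl ?_⟩
      rw [hc, sub_add_cancel, show x - (L 0 + L 1 : ZMod n) + L 0 = x - L 1 by ring,
        show x + (-(L 0 + L 1 : ZMod n) + L 0) = x - L 1 by ring, ← sub_eq_add_neg]
      grind
    · refine ⟨x - (L 0 + L 1), .inr ?_⟩
      rw [hc, sub_add_cancel, show x - (L 0 + L 1 : ZMod n) + L 1 = x - L 0 by ring,
        show x + (-(L 0 + L 1 : ZMod n) + L 1) = x - L 0 by ring, ← sub_eq_add_neg]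
      grind
    · exact absurd rfl hne
  · rintro ⟨y, rfl | rfl⟩
    · exact ⟨y, 1, by simp [simplex_three]⟩
    · exact ⟨y, Equiv.swap 0 1, by simp [simplex_three, add_comm]⟩

theorem mem_realization_tonn_iff {n : ℕ} [NeZero n] {L : Fin 3 → ℕ} (hsum : ∑ i, L i = n)
    (q : ZMod n → ℝ) : q ∈ realization (tonn n L) ↔ (∀ v, 0 ≤ q v) ∧ ∑ v, q v = 1 ∧
      ∃ y : ZMod n, (∀ v, q v ≠ 0 → v ∈ ({y, y + L 0, y + (L 0 + L 1)} : Finset (ZMod n))) ∨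
        (∀ v, q v ≠ 0 → v ∈ ({y, y + L 1, y + (L 0 + L 1)} : Finset (ZMod n))) := by
  refine and_congr_right fun _ => and_congr_right fun hq => ?_
  constructor
  · rintro ⟨s, ⟨-, x, σ, hs⟩, hqs⟩
    obtain ⟨y, hy | hy⟩ := (simplex_eq_iff hsum _).mp ⟨x, σ, rfl⟩
    · exact ⟨y, .inl fun v hv => hy ▸ hs (hqs v hv)⟩
    · exact ⟨y, .inr fun v hv => hy ▸ hs (hqs v hv)⟩
  · rintro ⟨y, h | h⟩
    · obtain ⟨x, σ, hs⟩ := (simplex_eq_iff hsum _).mpr ⟨y, .inl rfl⟩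
      exact ⟨_, ⟨⟨y, by simp⟩, x, σ, hs.le⟩, h⟩
    · obtain ⟨x, σ, hs⟩ := (simplex_eq_iff hsum _).mpr ⟨y, .inr rfl⟩
      exact ⟨_, ⟨⟨y, by simp⟩, x, σ, hs.le⟩, h⟩

theorem mem_face_iff_exists_single_add {V : Type*} [Fintype V] [DecidableEq V]
    {a b c : V} (hab : a ≠ b) (hac : a ≠ c) (hbc : b ≠ c) (q : V → ℝ) :
    ((∀ v, 0 ≤ q v) ∧ ∑ v, q v = 1 ∧ ∀ v, q v ≠ 0 → v ∈ ({a, b, c} : Finset V)) ↔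
      ∃ x y : ℝ, 0 ≤ y ∧ y ≤ x ∧ x ≤ 1 ∧
        q = Pi.single a (1 - x) + Pi.single b (x - y) + Pi.single c y := by
  constructor
  · rintro ⟨h0, h1, hs⟩
    have hq : q = Pi.single a (q a) + Pi.single b (q b) + Pi.single c (q c) := by
      funext v
      by_cases hv : q v = 0
      · rw [hv]
        simp only [Pi.add_apply, Pi.single_apply]
        split_ifs <;> simp_all
      · have := hs v hv
        simp only [Finset.mem_insert, Finset.mem_singleton] at this
        rcases this with rfl | rfl | rfl <;> simp [*, Ne.symm]
    have hsum : q a + q b + q c = 1 := by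
      rw [← h1]
      conv_rhs => rw [hq]
      simp [Finset.sum_add_distrib]
    refine ⟨q b + q c, q c, h0 c, by linarith [h0 b], by linarith [h0 a], ?_⟩
    rw [add_sub_cancel_right, show 1 - (q b + q c) = q a by linarith, ← hq]
  · rintro ⟨x, y, hy, hxy, hx, rfl⟩
    refine ⟨fun v => ?_, ?_, fun v hv => ?_⟩
    · simp only [Pi.add_apply, Pi.single_apply]
      split_ifs <;> linarith
    · simp [Finset.sum_add_distrib]
    · contrapose! hv
      simp only [Finset.mem_insert, Finset.mem_singleton, not_or] at hv
      simp [hv.1, hv.2.1, hv.2.2]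

theorem range_planeMap_latticeHom {n : ℕ} [NeZero n] {L : Fin 3 → ℕ} (hpos : ∀ i, 0 < L i)
    (hsum : ∑ i, L i = n) (hgen : IsGeneric L) (hred : IsReduced L) :
    Set.range (planeMap (latticeHom n L)) = realization (tonn n L) := by
  have hinj := latticeHom_injOn_starPoints hpos hsum hgen
  -- Each triangle at `z` must have three distinct labels, so that `planeMap` covers the whole face.
  have hne : ∀ u ∈ starPoints, ∀ w ∈ starPoints, u ≠ w → ∀ z,
      latticeHom n L (u + z) ≠ latticeHom n L (w + z) := fun u hu w hw huw z h =>
    huw (hinj hu hw (add_right_cancel (by simpa only [map_add] using h)))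
  have hval : ∀ z : ℤ × ℤ, latticeHom n L ((0, 0) + z) = latticeHom n L z ∧
      latticeHom n L ((1, 0) + z) = latticeHom n L z + L 0 ∧
      latticeHom n L ((0, 1) + z) = latticeHom n L z + L 1 ∧
      latticeHom n L ((1, 1) + z) = latticeHom n L z + (L 0 + L 1) := by
    intro z
    simp only [map_add, latticeHom_apply]
    refine ⟨?_, ?_, ?_, ?_⟩ <;> push_cast <;> ring
  have hlow : ∀ (z : ℤ × ℤ) (q : ZMod n → ℝ), ((∀ v, 0 ≤ q v) ∧ ∑ v, q v = 1 ∧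
      ∀ v, q v ≠ 0 → v ∈ ({latticeHom n L z, latticeHom n L z + L 0,
        latticeHom n L z + (L 0 + L 1)} : Finset (ZMod n))) ↔
      ∃ x y : ℝ, 0 ≤ y ∧ y ≤ x ∧ x ≤ 1 ∧ q = planeMap (latticeHom n L) ((x, y) + toPlane z) := by
    intro z q
    obtain ⟨e0, e1, e2, e3⟩ := hval z
    rw [← e3, ← e1, ← e0, mem_face_iff_exists_single_add
      (hne _ (by decide) _ (by decide) (by decide) z)
      (hne _ (by decide) _ (by decide) (by decide) z)
      (hne _ (by decide) _ (by decide) (by decide) z)]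
    refine exists₂_congr fun x y => and_congr_right fun hy => and_congr_right fun hxy =>
      and_congr_right fun hx => ?_
    rw [planeMap_add_toPlane, planeMap_of_le _ hy hxy hx]
  have hupp : ∀ (z : ℤ × ℤ) (q : ZMod n → ℝ), ((∀ v, 0 ≤ q v) ∧ ∑ v, q v = 1 ∧
      ∀ v, q v ≠ 0 → v ∈ ({latticeHom n L z, latticeHom n L z + L 1,
        latticeHom n L z + (L 0 + L 1)} : Finset (ZMod n))) ↔
      ∃ y x : ℝ, 0 ≤ x ∧ x ≤ y ∧ y ≤ 1 ∧ q = planeMap (latticeHom n L) ((x, y) + toPlane z) := by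
    intro z q
    obtain ⟨e0, e1, e2, e3⟩ := hval z
    rw [← e3, ← e2, ← e0, mem_face_iff_exists_single_add
      (hne _ (by decide) _ (by decide) (by decide) z)
      (hne _ (by decide) _ (by decide) (by decide) z)
      (hne _ (by decide) _ (by decide) (by decide) z)]
    refine exists₂_congr fun y x => and_congr_right fun hx => and_congr_right fun hxy =>
      and_congr_right fun hy => ?_
    rw [planeMap_add_toPlane, show (x, y) = (y, x).swap from rfl, planeMap_swap,
      planeMap_of_le _ hx hxy hy]
    rfl
  ext q
  rw [mem_realization_tonn_iff hsum]
  constructor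
  · rintro ⟨⟨s, t⟩, rfl⟩
    have hst : (s, t) = (Int.fract s, Int.fract t) + toPlane (⌊s⌋, ⌊t⌋) := by
      simp [toPlane]
    rcases le_total (Int.fract t) (Int.fract s) with h | h
    · obtain ⟨h1, h2, h3⟩ := (hlow (⌊s⌋, ⌊t⌋) (planeMap (latticeHom n L) (s, t))).mpr
        ⟨_, _, Int.fract_nonneg t, h, (Int.fract_lt_one s).le, congrArg _ hst⟩
      exact ⟨h1, h2, _, .inl h3⟩
    · obtain ⟨h1, h2, h3⟩ := (hupp (⌊s⌋, ⌊t⌋) (planeMap (latticeHom n L) (s, t))).mpr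
        ⟨_, _, Int.fract_nonneg s, h, (Int.fract_lt_one t).le, congrArg _ hst⟩
      exact ⟨h1, h2, _, .inr h3⟩
  · rintro ⟨h1, h2, y, h⟩
    obtain ⟨z, rfl⟩ := latticeHom_surjective hsum hred y
    rcases h with h3 | h3
    · obtain ⟨_, _, -, -, -, rfl⟩ := (hlow z q).mp ⟨h1, h2, h3⟩
      exact ⟨_, rfl⟩
    · obtain ⟨_, _, -, -, -, rfl⟩ := (hupp z q).mp ⟨h1, h2, h3⟩
      exact ⟨_, rfl⟩

end Tonnetz

open Tonnetz in
theorem mainTheorem11 (n : ℕ) [NeZero n] (L : Fin 3 → ℕ) (hpos : ∀ i, 0 < L i)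
    (hsum : ∑ i, L i = n) (hgen : Tonnetz.IsGeneric L) (hred : Tonnetz.IsReduced L) :
    Tonnetz.IsTriangulationOf (Tonnetz.tonn n L) (Circle × Circle) := by
  have hinj := latticeHom_injOn_starPoints hpos hsum hgen
  have hrange := range_planeMap_latticeHom hpos hsum hgen hred
  have hmem : ∀ p, planeMap (latticeHom n L) p ∈ realization (tonn n L) :=
    fun p => hrange ▸ Set.mem_range_self p
  have hne : ∀ p, planeMap (latticeHom n L) p ≠ 0 := fun p h => by
    simpa [h] using (hmem p).2.1
  obtain ⟨A, C, D, hA, hD, hker⟩ := exists_kernel_basis (latticeHom n L)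
  have hA' : (A : ℝ) ≠ 0 := Int.cast_ne_zero.mpr hA
  have hD' : (D : ℝ) ≠ 0 := Int.cast_ne_zero.mpr hD
  -- The linear change of coordinates carrying `ℤ × ℤ` onto the kernel, so that the fibres of the
  -- composite are `ℤ × ℤ`-orbits.
  let T : ℝ × ℝ → ℝ × ℝ := fun p => (p.1 * A + p.2 * C, p.2 * D)
  have hT : Function.Bijective T := by
    refine Function.bijective_iff_has_inverse.mpr
      ⟨fun p => ((p.1 - p.2 / D * C) / A, p.2 / D), fun p => ?_, fun p => ?_⟩
    · ext <;> simp [T, hA', hD']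
    · ext <;> simp [T, hA', hD']
  have hTadd : ∀ q (w : ℤ × ℤ), T (q + toPlane w) =
      T q + toPlane (w.1 * A + w.2 * C, w.2 * D) := by
    intro q w
    ext <;> simp [T, toPlane] <;> ring
  refine nonempty_homeomorph_torus (fun p => ⟨planeMap (latticeHom n L) (T p), hmem _⟩) ?_ ?_ ?_
  · exact ((continuous_planeMap _).comp (by fun_prop)).subtype_mk _
  · rintro ⟨q, hq⟩
    rw [← hrange] at hq
    obtain ⟨p, rfl⟩ := hq
    obtain ⟨p, rfl⟩ := hT.2 p
    exact ⟨p, rfl⟩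
  · intro p q
    rw [Subtype.mk.injEq, planeMap_eq_iff _ hinj (hne _)]
    constructor
    · rintro ⟨w, hw, h⟩
      obtain ⟨i, j, rfl⟩ := (hker w).mp hw
      exact ⟨(i, j), hT.1 (h.trans (hTadd q (i, j)).symm)⟩
    · rintro ⟨w, rfl⟩
      exact ⟨_, (hker _).mpr ⟨w.1, w.2, rfl⟩, hTadd q w⟩
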